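/- There is a function $g:\mathbb{N}\to\mathbb{R}$ with $g(k)=O(\log k)$ as $k\to\infty$ such that the following holds for all integers $n\ge 1$, $k\ge 1$, $0\le d\le n$ and every symmetric $F\in\mathbb{R}^{n\times n}$. Let $\|\cdot\|$ denote the Frobenius norm. Let $\lambda_1,\dots,\lambda_d$ be $d$ eigenvalues of $F$ of largest absolute value (with multiplicity), $|\lambda_1|\ge\dots\ge|\lambda_d|$, and let $V\in\mathbb{R}^{n\times d}$ have corresponding orthonormal eigenvectors as its columns. Put $S=\mathrm{diag}(\operatorname{sign}\lambda_i)$ and $U=V\,\mathrm{diag}(\sqrt{|\lambda_i|})$. For a partition of the $n$ rows of $U$ into at most $k$ clusters let $U_c$ be the matrix obtained from $U$ by replacing each row by the centroid of its cluster, and let $\phi_{OPT,k}$ be the minimum of the clustering objective $\|U-U_c\|$ over all such partitions. Cluster the rows of $U$ with k-means++: the first seed is a uniformly random row; each further seed, up to $k$ seeds, is a row drawn with probability proportional to its squared Euclidean distance to the nearest previous seed (uniformly if all these distances vanish); then rows are assigned to nearest centers, followed by any finite number (which may depend on the seeds) of Lloyd rounds, each of which moves the center of every non-empty cluster to its centroid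 and reassigns the rows to nearest centers, with ties broken by any rule. With $U_c$ given by the resulting random clustering and $\overline F=U_cSU_c^{T}$, $$\mathbb{E}\big[\|F-\overline F\|\big]\;\le\;\min_{\operatorname{rank} B\le d}\|F-B\|\;+\;2\sqrt{\textstyle\sum_{i=1}^{d}|\lambda_i|}\;\cdot g(k)\cdot\phi_{OPT,k}.$$ -/

import Mathlib

open Filter Asymptotics
open scoped Matrix

attribute [local instance] Matrix.frobeniusNormedAddCommGroup

noncomputable section

namespace SpectralBlock

/-! ### Truncated eigendecomposition -/

/-- `lam` and the columns of `V` are `d` eigenvalues of largest absolute value of `F` (counted with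
multiplicity, in decreasing order of absolute value) and corresponding orthonormal eigenvectors:
no eigenvector orthogonal to the chosen ones has an eigenvalue of larger absolute value. -/
structure IsTopEigenpairs {n d : ℕ} (F : Matrix (Fin n) (Fin n) ℝ)
    (lam : Fin d → ℝ) (V : Matrix (Fin n) (Fin d) ℝ) : Prop where
  orthonormal : Vᵀ * V = 1
  eigen : F * V = V * Matrix.diagonal lam
  sorted : Antitone fun i => |lam i|
  top : ∀ (μ : ℝ) (x : Fin n → ℝ), x ≠ 0 → F *ᵥ x = μ • x → Vᵀ *ᵥ x = 0 →
    ∀ i, |μ| ≤ |lam i|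

/-- The rescaled eigenvectors `U = V √Σ`, where `Σ = diag |lam i|`. -/
def rescaled {n d : ℕ} (lam : Fin d → ℝ) (V : Matrix (Fin n) (Fin d) ℝ) :
    Matrix (Fin n) (Fin d) ℝ :=
  V * Matrix.diagonal fun i => Real.sqrt |lam i|

/-- The diagonal matrix `S` of the signs of the eigenvalues. -/
def signs {d : ℕ} (lam : Fin d → ℝ) : Matrix (Fin d) (Fin d) ℝ :=
  Matrix.diagonal fun i => Real.sign (lam i)

/-! ### Clusterings of a family of points -/

section KMeans

variable {E : Type*} [NormedAddCommGroup E] [NormedSpace ℝ E] {n k : ℕ}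

/-- The centroid (mean) of the `j`-th cluster of the clustering `a`. -/
def centroid (X : Fin n → E) (a : Fin n → Fin k) (j : Fin k) : E :=
  ((Finset.univ.filter fun i => a i = j).card : ℝ)⁻¹ •
    ∑ i ∈ Finset.univ.filter (fun i => a i = j), X i

/-- `a` assigns every point to a nearest one of the centers `c` (ties broken in any way). -/
def IsNearest (X : Fin n → E) (c : Fin k → E) (a : Fin n → Fin k) : Prop :=
  ∀ i j, ‖X i - c (a i)‖ ≤ ‖X i - c j‖

open Classical in
/-- The center update of Lloyd's iteration: every center moves to the centroid of its cluster;
the center of an empty cluster stays where it is. -/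
def updateCenters (X : Fin n → E) (c : Fin k → E) (a : Fin n → Fin k) : Fin k → E :=
  fun j => if ∃ i, a i = j then centroid X a j else c j

/-- `LloydOutput X c a`: the clustering `a` is obtained from the initial centers `c` by a finite
number of rounds of Lloyd's iteration. A single round only assigns the points to nearest centers. -/
inductive LloydOutput (X : Fin n → E) : (Fin k → E) → (Fin n → Fin k) → Prop
  | assign {c : Fin k → E} {a : Fin n → Fin k} :
      IsNearest X c a → LloydOutput X c a
  | iterate {c : Fin k → E} {a a' : Fin n → Fin k} :
      IsNearest X c a → LloydOutput X (updateCenters X c a) a' → LloydOutput X c a'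

/-! ### The k-means++ seeding -/

/-- The squared distance `D²` of the point `X i` to the nearest center among the points chosen
so far, whose indices are listed by `z`. It is only used when some point has been chosen. -/
def sqDist {m : ℕ} (X : Fin n → E) (z : Fin m → Fin n) (i : Fin n) : ℝ :=
  ⨅ j : Fin m, ‖X i - X (z j)‖ ^ 2

open Classical in
/-- The law of the next center: the first center is uniform, every further one is drawn with
probability proportional to `D²`. If every point already coincides with a center, all these
weights vanish and the draw is uniform. -/
def nextCenter [NeZero n] {m : ℕ} (X : Fin n → E) (z : Fin m → Fin n) : PMF (Fin n) :=
  if h : m ≠ 0 ∧ ∑ i, ENNReal.ofReal (sqDist X z i) ≠ 0 then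
    PMF.normalize (fun i => ENNReal.ofReal (sqDist X z i))
      (by rw [tsum_fintype]; exact h.2)
      (by rw [tsum_fintype]; exact ENNReal.sum_ne_top.2 fun _ _ => ENNReal.ofReal_ne_top)
  else PMF.uniformOfFintype (Fin n)

/-- The law of the indices of the first `m` centers chosen by k-means++. -/
def seeding [NeZero n] (X : Fin n → E) : (m : ℕ) → PMF (Fin m → Fin n)
  | 0 => PMF.pure Fin.elim0
  | m + 1 => (seeding X m).bind fun z =>
      (nextCenter X z).map fun i => (Fin.snoc z i : Fin (m + 1) → Fin n)

end KMeans

/-- The expectation of a real function on a finite probability space. -/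
def expectation {Ω : Type*} [Fintype Ω] (p : PMF Ω) (f : Ω → ℝ) : ℝ :=
  ∑ ω, (p ω).toReal * f ω

/-! ### Clustering the rows of a matrix -/

/-- The rows of `U`, as points of Euclidean space. -/
def rows {n d : ℕ} (U : Matrix (Fin n) (Fin d) ℝ) (i : Fin n) : EuclideanSpace ℝ (Fin d) :=
  WithLp.toLp 2 (U i)

/-- The matrix `U_c`: each row of `U` is replaced by the centroid of its cluster. -/
def replaceRows {n d k : ℕ} (U : Matrix (Fin n) (Fin d) ℝ) (a : Fin n → Fin k) :
    Matrix (Fin n) (Fin d) ℝ :=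
  Matrix.of fun i j => centroid (rows U) a (a i) j

/-- The optimal value over all clusterings into at most `k` clusters of the clustering objective
`‖U - U_c‖` (Frobenius norm). -/
def phiOpt {n d : ℕ} (U : Matrix (Fin n) (Fin d) ℝ) (k : ℕ) : ℝ :=
  ⨅ a : Fin n → Fin k, ‖U - replaceRows U a‖

/-- The block approximation `U_c S U_cᵀ` given by the clustering `a` of the rows of `U`. -/
def blockApprox {n d k : ℕ} (lam : Fin d → ℝ) (V : Matrix (Fin n) (Fin d) ℝ)
    (a : Fin n → Fin k) : Matrix (Fin n) (Fin n) ℝ :=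
  replaceRows (rescaled lam V) a * signs lam * (replaceRows (rescaled lam V) a)ᵀ

/-- `A` is the deterministic part of a run of k-means++ with `k` clusters on the rows of `U`: it
sends the indices of the seeds to a clustering reached from these seeds by a finite number of
rounds of Lloyd's iteration (any stopping rule, any breaking of ties). -/
def IsKMeansRun {n d k : ℕ} (U : Matrix (Fin n) (Fin d) ℝ)
    (A : (Fin k → Fin n) → (Fin n → Fin k)) : Prop :=
  ∀ z : Fin k → Fin n, LloydOutput (rows U) (fun j => rows U (z j)) (A z)

end SpectralBlock

end

/-!
With `U = V √|Λ|` one has `U S Uᵀ = V Λ Vᵀ`, the truncated eigendecomposition of `F`. The error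
`F - U_c S U_cᵀ` splits into two parts.

* The truncation error `F - V Λ Vᵀ` is at most `‖F - B‖` for every `B` of rank at most `d`
  (`norm_sub_truncation_le`). If `q` is an orthonormal basis of the range of `B`, then
  `‖F - B‖² ≥ ‖F‖² - ∑ ‖F q_l‖²`, and by a Ky Fan type maximum principle (`sum_sq_norm_apply_le`)
  the last sum is at most `∑ λ_i²`, while `‖F - V Λ Vᵀ‖² = ‖F‖² - ∑ λ_i²`.
* The clustering error `U S Uᵀ - U_c S U_cᵀ` is at most `2 ‖U‖ ‖U - U_c‖`, since averaging rows
  does not increase the Frobenius norm; moreover `‖U‖² = ∑ |λ_i|`.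

What remains is the expectation of `‖U - U_c‖`. Lloyd's rounds do not increase the squared objective
(`LloydOutput.sum_clusterCost_le`), so that it is at most the `D²` potential of the seeds. That the
expected potential is at most `8 (log k + 2)` times the optimal cost is the theorem of Arthur and
Vassilvitskii (`expectation_seeding_sum_sqDist_le`). Fix an optimal clustering. A first seed in one of
its clusters brings the expected potential of the cluster down to a multiple of its optimal cost: 2
for a uniform seed, 8 for a seed drawn with `D²` weights. Seeds wasted on clusters that already
contain a seed are accounted for by the quantity `potentialBound`, which does not increase on average
when a seed is drawn. After the first seed its expectation is at most eight times the optimal cost, up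
to a harmonic factor, and after the last seed it bounds the potential. Jensen's inequality then passes from the
squared objective to the objective.
-/

namespace SpectralBlock

/-! ### Centroids and Lloyd's iteration -/

section Centroids

variable {E : Type*} [NormedAddCommGroup E] [InnerProductSpace ℝ E] {n k : ℕ}

/-- The squared clustering objective of the `j`-th cluster of `a`, with respect to its centroid. -/
noncomputable def clusterCost (X : Fin n → E) (a : Fin n → Fin k) (j : Fin k) : ℝ :=
  ∑ i ∈ Finset.univ.filter (fun i => a i = j), ‖X i - centroid X a j‖ ^ 2

lemma clusterCost_nonneg (X : Fin n → E) (a : Fin n → Fin k) (j : Fin k) :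
    0 ≤ clusterCost X a j :=
  Finset.sum_nonneg fun _ _ => by positivity

lemma sum_sub_centroid (X : Fin n → E) (a : Fin n → Fin k) (j : Fin k) :
    ∑ i ∈ Finset.univ.filter (fun i => a i = j), (X i - centroid X a j) = 0 := by
  rcases (Finset.univ.filter (fun i => a i = j)).eq_empty_or_nonempty with h | h
  · simp [h]
  · have hc : ((Finset.univ.filter fun i => a i = j).card : ℝ) ≠ 0 := by
      exact_mod_cast h.card_pos.ne'
    rw [Finset.sum_sub_distrib, Finset.sum_const, centroid, ← Nat.cast_smul_eq_nsmul ℝ,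
      smul_smul, mul_inv_cancel₀ hc, one_smul, sub_self]

/-- Decomposition of the moment of a cluster about `y` into its moment about the centroid and the
contribution of the distance of the centroid to `y` (the parallel axis theorem). -/
lemma sum_sq_norm_sub_eq (X : Fin n → E) (a : Fin n → Fin k) (j : Fin k) (y : E) :
    ∑ i ∈ Finset.univ.filter (fun i => a i = j), ‖X i - y‖ ^ 2 =
      clusterCost X a j +
        ((Finset.univ.filter fun i => a i = j).card : ℝ) * ‖centroid X a j - y‖ ^ 2 := by
  have h : ∀ i, ‖X i - y‖ ^ 2 = ‖X i - centroid X a j‖ ^ 2 +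
      2 * inner ℝ (X i - centroid X a j) (centroid X a j - y) + ‖centroid X a j - y‖ ^ 2 := by
    intro i
    rw [← norm_add_sq_real, sub_add_sub_cancel]
  simp_rw [h]
  rw [Finset.sum_add_distrib, Finset.sum_add_distrib, ← Finset.mul_sum, ← sum_inner,
    sum_sub_centroid, inner_zero_left, clusterCost, Finset.sum_const, nsmul_eq_mul]
  ring

lemma clusterCost_le (X : Fin n → E) (a : Fin n → Fin k) (j : Fin k) (y : E) :
    clusterCost X a j ≤ ∑ i ∈ Finset.univ.filter (fun i => a i = j), ‖X i - y‖ ^ 2 := by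
  rw [sum_sq_norm_sub_eq]
  have : 0 ≤ ((Finset.univ.filter fun i => a i = j).card : ℝ) * ‖centroid X a j - y‖ ^ 2 := by
    positivity
  linarith

/-- The sum of the squared distances of all pairs of points of a cluster. -/
lemma sum_sum_sq_norm_sub (X : Fin n → E) (a : Fin n → Fin k) (j : Fin k) :
    ∑ i ∈ Finset.univ.filter (fun i => a i = j),
        ∑ l ∈ Finset.univ.filter (fun i => a i = j), ‖X l - X i‖ ^ 2 =
      2 * ((Finset.univ.filter fun i => a i = j).card : ℝ) * clusterCost X a j := by
  simp_rw [sum_sq_norm_sub_eq, norm_sub_rev (centroid X a j)]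
  rw [Finset.sum_add_distrib, ← Finset.mul_sum, Finset.sum_const, nsmul_eq_mul, ← clusterCost]
  ring

/-- The squared clustering objective is the sum of the costs of the clusters. -/
lemma sum_clusterCost (X : Fin n → E) (a : Fin n → Fin k) :
    ∑ j, clusterCost X a j = ∑ i, ‖X i - centroid X a (a i)‖ ^ 2 := by
  rw [← Finset.sum_fiberwise Finset.univ a]
  refine Finset.sum_congr rfl fun j _ => Finset.sum_congr rfl fun i hi => ?_
  rw [(Finset.mem_filter.1 hi).2]

lemma sum_clusterCost_le (X : Fin n → E) (a : Fin n → Fin k) (c : Fin k → E) :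
    ∑ j, clusterCost X a j ≤ ∑ i, ‖X i - c (a i)‖ ^ 2 := by
  rw [← Finset.sum_fiberwise Finset.univ a]
  refine Finset.sum_le_sum fun j _ => (clusterCost_le X a j (c j)).trans_eq ?_
  refine Finset.sum_congr rfl fun i hi => ?_
  rw [(Finset.mem_filter.1 hi).2]

/-- Lloyd's iteration never increases the squared objective: its result costs at most as much as
any assignment of the points to the initial centers. -/
lemma LloydOutput.sum_clusterCost_le {X : Fin n → E} {c : Fin k → E} {a : Fin n → Fin k}
    (h : LloydOutput X c a) (b : Fin n → Fin k) :
    ∑ j, clusterCost X a j ≤ ∑ i, ‖X i - c (b i)‖ ^ 2 := by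
  have nearest : ∀ {c : Fin k → E} {a : Fin n → Fin k}, IsNearest X c a → ∀ b : Fin n → Fin k,
      ∑ i, ‖X i - c (a i)‖ ^ 2 ≤ ∑ i, ‖X i - c (b i)‖ ^ 2 := fun h b =>
    Finset.sum_le_sum fun i _ => pow_le_pow_left₀ (norm_nonneg _) (h i (b i)) 2
  induction h generalizing b with
  | assign h => exact (SpectralBlock.sum_clusterCost_le X _ _).trans (nearest h b)
  | @iterate c a a' h _ ih =>
    refine (ih a).trans (le_trans ?_ (nearest h b))
    refine le_trans (le_of_eq ?_) (SpectralBlock.sum_clusterCost_le X a c)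
    rw [sum_clusterCost]
    refine Finset.sum_congr rfl fun i _ => ?_
    rw [updateCenters, if_pos ⟨i, rfl⟩]

/-- The clustering reached from seeds among the points costs at most the `D²` potential of the
seeds. -/
lemma LloydOutput.sum_clusterCost_le_sum_sqDist {X : Fin n → E} {z : Fin k → Fin n}
    {a : Fin n → Fin k} (hk : 1 ≤ k) (h : LloydOutput X (fun j => X (z j)) a) :
    ∑ j, clusterCost X a j ≤ ∑ i, sqDist X z i := by
  have : Nonempty (Fin k) := ⟨⟨0, hk⟩⟩
  choose b hb using fun i => exists_eq_ciInf_of_finite (f := fun j => ‖X i - X (z j)‖ ^ 2)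
  exact (h.sum_clusterCost_le b).trans_eq (Finset.sum_congr rfl fun i _ => hb i)

end Centroids

/-! ### One step of the k-means++ seeding -/

section Seeding

variable {E : Type*} [NormedAddCommGroup E] {n k m : ℕ}

lemma sqDist_nonneg (X : Fin n → E) (z : Fin m → Fin n) (i : Fin n) : 0 ≤ sqDist X z i :=
  Real.iInf_nonneg fun _ => by positivity

lemma sqDist_le (X : Fin n → E) (z : Fin m → Fin n) (i : Fin n) (j : Fin m) :
    sqDist X z i ≤ ‖X i - X (z j)‖ ^ 2 :=
  ciInf_le (Set.finite_range _).bddBelow j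

lemma sqDist_snoc_le_sq_norm (X : Fin n → E) (z : Fin m → Fin n) (l i : Fin n) :
    sqDist X (Fin.snoc z l : Fin (m + 1) → Fin n) i ≤ ‖X i - X l‖ ^ 2 := by
  simpa using sqDist_le X (Fin.snoc z l : Fin (m + 1) → Fin n) i (Fin.last m)

lemma sqDist_snoc_le (X : Fin n → E) (z : Fin m → Fin n) (hm : m ≠ 0) (l i : Fin n) :
    sqDist X (Fin.snoc z l : Fin (m + 1) → Fin n) i ≤ sqDist X z i := by
  have : Nonempty (Fin m) := ⟨⟨0, Nat.pos_of_ne_zero hm⟩⟩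
  refine le_ciInf fun j => ?_
  simpa using sqDist_le X (Fin.snoc z l : Fin (m + 1) → Fin n) i j.castSucc

lemma sqDist_le_two_mul (X : Fin n → E) (z : Fin m → Fin n) (i l : Fin n) :
    sqDist X z i ≤ 2 * sqDist X z l + 2 * ‖X l - X i‖ ^ 2 := by
  rcases isEmpty_or_nonempty (Fin m) with h | h
  · simp only [sqDist, Real.iInf_of_isEmpty]
    positivity
  · obtain ⟨j, hj⟩ := exists_eq_ciInf_of_finite (f := fun j => ‖X l - X (z j)‖ ^ 2)
    have h1 : sqDist X z l = ‖X l - X (z j)‖ ^ 2 := hj.symm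
    have h2 : ‖X i - X (z j)‖ ≤ ‖X l - X i‖ + ‖X l - X (z j)‖ := by
      rw [norm_sub_rev (X l)]
      exact norm_sub_le_norm_sub_add_norm_sub _ _ _
    have h3 := pow_le_pow_left₀ (norm_nonneg _) h2 2
    have h4 := sqDist_le X z i j
    nlinarith [sq_nonneg (‖X l - X i‖ - ‖X l - X (z j)‖)]

/-- The `D²` potential of the `j`-th cluster of `a` with respect to the seeds `z`. -/
noncomputable def potential (X : Fin n → E) (a : Fin n → Fin k) (z : Fin m → Fin n) (j : Fin k) : ℝ :=
  ∑ i ∈ Finset.univ.filter (fun i => a i = j), sqDist X z i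

lemma potential_nonneg (X : Fin n → E) (a : Fin n → Fin k) (z : Fin m → Fin n) (j : Fin k) :
    0 ≤ potential X a z j :=
  Finset.sum_nonneg fun _ _ => sqDist_nonneg _ _ _

lemma sum_potential (X : Fin n → E) (a : Fin n → Fin k) (z : Fin m → Fin n) :
    ∑ j, potential X a z j = ∑ i, sqDist X z i :=
  Finset.sum_fiberwise Finset.univ a _

lemma potential_snoc_le (X : Fin n → E) (a : Fin n → Fin k) (z : Fin m → Fin n) (hm : m ≠ 0)
    (l : Fin n) (j : Fin k) :
    potential X a (Fin.snoc z l : Fin (m + 1) → Fin n) j ≤ potential X a z j :=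
  Finset.sum_le_sum fun i _ => sqDist_snoc_le X z hm l i

variable [InnerProductSpace ℝ E]

/-- A uniformly chosen seed in a cluster costs on average at most twice the optimal cost. -/
lemma sum_potential_snoc_le (X : Fin n → E) (a : Fin n → Fin k) (z : Fin m → Fin n) (j : Fin k) :
    ∑ l ∈ Finset.univ.filter (fun i => a i = j),
        potential X a (Fin.snoc z l : Fin (m + 1) → Fin n) j ≤
      2 * ((Finset.univ.filter fun i => a i = j).card : ℝ) * clusterCost X a j := by
  rw [← sum_sum_sq_norm_sub]
  exact Finset.sum_le_sum fun l _ => Finset.sum_le_sum fun i _ => sqDist_snoc_le_sq_norm X z l i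

/-- A seed drawn from a cluster with `D²` weights costs on average at most eight times the optimal
cost. Averaging `D²(l) ≤ 2 D²(i) + 2 ‖X i - X l‖²` over `i` bounds the weight of `l` by two terms.
The first one, the average potential, is combined with the bound `∑ ‖X i - X l‖²` for the new
potential, the second one, the average of `‖X i - X l‖²`, with the bound by the old potential. -/
lemma sum_sqDist_mul_potential_snoc_le (X : Fin n → E) (a : Fin n → Fin k) (z : Fin m → Fin n)
    (hm : m ≠ 0) (j : Fin k) :
    ∑ l ∈ Finset.univ.filter (fun i => a i = j),
        sqDist X z l * potential X a (Fin.snoc z l : Fin (m + 1) → Fin n) j ≤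
      potential X a z j * (8 * clusterCost X a j) := by
  set s := Finset.univ.filter (fun i => a i = j) with hs
  rcases s.eq_empty_or_nonempty with h | h
  · rw [h, Finset.sum_empty]
    exact mul_nonneg (potential_nonneg _ _ _ _)
      (mul_nonneg (by norm_num) (clusterCost_nonneg _ _ _))
  have hc : (0 : ℝ) < s.card := by exact_mod_cast h.card_pos
  have hφ := potential_nonneg X a z j
  have key : ∀ l ∈ s, (s.card : ℝ) *
      (sqDist X z l * potential X a (Fin.snoc z l : Fin (m + 1) → Fin n) j) ≤
      4 * potential X a z j * ∑ i ∈ s, ‖X i - X l‖ ^ 2 := by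
    intro l _
    have h1 : (s.card : ℝ) * sqDist X z l ≤
        2 * potential X a z j + 2 * ∑ i ∈ s, ‖X i - X l‖ ^ 2 := by
      rw [potential, ← nsmul_eq_mul, ← Finset.sum_const, Finset.mul_sum, Finset.mul_sum,
        ← Finset.sum_add_distrib]
      exact Finset.sum_le_sum fun i _ => sqDist_le_two_mul X z l i
    have h2 : potential X a (Fin.snoc z l : Fin (m + 1) → Fin n) j ≤ ∑ i ∈ s, ‖X i - X l‖ ^ 2 :=
      Finset.sum_le_sum fun i _ => sqDist_snoc_le_sq_norm X z l i
    have h3 := potential_snoc_le X a z hm l j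
    have h4 := potential_nonneg X a (Fin.snoc z l : Fin (m + 1) → Fin n) j
    have h5 : 0 ≤ ∑ i ∈ s, ‖X i - X l‖ ^ 2 := Finset.sum_nonneg fun _ _ => by positivity
    nlinarith [mul_le_mul_of_nonneg_right h1 h4, mul_le_mul_of_nonneg_left h2 hφ,
      mul_le_mul_of_nonneg_right h3 h5]
  have h6 := Finset.sum_le_sum key
  rw [← Finset.mul_sum, ← Finset.mul_sum, sum_sum_sq_norm_sub, ← hs] at h6
  refine le_of_mul_le_mul_left (h6.trans_eq ?_) hc
  ring

end Seeding

/-! ### Expectations over finite probability spaces -/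

section Expectation

variable {Ω Ω' : Type*} [Fintype Ω] [Fintype Ω']

lemma sum_toReal_eq_one (p : PMF Ω) : ∑ ω, (p ω).toReal = 1 := by
  rw [← ENNReal.toReal_sum fun ω _ => p.apply_ne_top ω, ← tsum_fintype (L := .unconditional Ω),
    p.tsum_coe, ENNReal.toReal_one]

lemma expectation_mono (p : PMF Ω) {f g : Ω → ℝ} (h : ∀ ω, f ω ≤ g ω) :
    expectation p f ≤ expectation p g :=
  Finset.sum_le_sum fun ω _ => mul_le_mul_of_nonneg_left (h ω) ENNReal.toReal_nonneg

lemma expectation_const_add_mul (p : PMF Ω) (b c : ℝ) (f : Ω → ℝ) :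
    expectation p (fun ω => b + c * f ω) = b + c * expectation p f := by
  simp only [expectation, mul_add, Finset.sum_add_distrib, ← Finset.sum_mul, sum_toReal_eq_one,
    one_mul, Finset.mul_sum]
  congr 1
  exact Finset.sum_congr rfl fun _ _ => by ring

lemma sq_expectation_le (p : PMF Ω) {f : Ω → ℝ} (hf : ∀ ω, 0 ≤ f ω) :
    expectation p f ^ 2 ≤ expectation p (fun ω => f ω ^ 2) :=
  Real.pow_arith_mean_le_arith_mean_pow Finset.univ _ f (fun _ _ => ENNReal.toReal_nonneg)
    (sum_toReal_eq_one p) (fun ω _ => hf ω) 2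

lemma expectation_bind (p : PMF Ω) (q : Ω → PMF Ω') (f : Ω' → ℝ) :
    expectation (p.bind q) f = expectation p fun ω => expectation (q ω) f := by
  have h : ∀ ω', ((p.bind q) ω').toReal = ∑ ω, (p ω).toReal * (q ω ω').toReal := by
    intro ω'
    rw [PMF.bind_apply, tsum_fintype, ENNReal.toReal_sum
      fun ω _ => ENNReal.mul_ne_top (p.apply_ne_top _) ((q ω).apply_ne_top _)]
    simp only [ENNReal.toReal_mul]
  simp only [expectation, h, Finset.sum_mul, Finset.mul_sum]
  rw [Finset.sum_comm]
  exact Finset.sum_congr rfl fun _ _ => Finset.sum_congr rfl fun _ _ => by ring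

lemma expectation_pure (ω : Ω) (f : Ω → ℝ) : expectation (PMF.pure ω) f = f ω := by
  classical
  rw [expectation, Finset.sum_eq_single ω]
  · simp
  · intro b _ hb
    simp [hb]
  · simp

lemma expectation_map (p : PMF Ω) (g : Ω → Ω') (f : Ω' → ℝ) :
    expectation (p.map g) f = expectation p fun ω => f (g ω) := by
  rw [PMF.map, expectation_bind]
  simp only [Function.comp_apply, expectation_pure]

lemma expectation_uniformOfFintype [Nonempty Ω] (f : Ω → ℝ) :
    expectation (PMF.uniformOfFintype Ω) f = (Fintype.card Ω : ℝ)⁻¹ * ∑ ω, f ω := by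
  simp [expectation, PMF.uniformOfFintype_apply, Finset.mul_sum]

end Expectation

/-! ### The expected potential of the k-means++ seeding -/

section Potential

variable {E : Type*} [NormedAddCommGroup E] {n k m : ℕ}

lemma expectation_seeding_succ [NeZero n] (X : Fin n → E) (f : (Fin (m + 1) → Fin n) → ℝ) :
    expectation (seeding X (m + 1)) f =
      expectation (seeding X m) fun z =>
        expectation (nextCenter X z) fun i => f (Fin.snoc z i) := by
  rw [seeding, expectation_bind]
  simp only [expectation_map]

lemma expectation_nextCenter_zero [NeZero n] (X : Fin n → E) (z : Fin 0 → Fin n) (f : Fin n → ℝ) :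
    expectation (nextCenter X z) f = (n : ℝ)⁻¹ * ∑ i, f i := by
  rw [nextCenter, dif_neg (by simp), expectation_uniformOfFintype, Fintype.card_fin]

/-- To bound an expectation over a `D²` draw it suffices to bound the sum with the weights `D²`,
and to have a pointwise bound in the degenerate case where all weights vanish. -/
lemma expectation_nextCenter_le [NeZero n] (X : Fin n → E) (z : Fin m → Fin n) (hm : m ≠ 0)
    (f : Fin n → ℝ) (K : ℝ) (h : ∑ i, sqDist X z i * f i ≤ (∑ i, sqDist X z i) * K)
    (h0 : (∀ i, sqDist X z i = 0) → ∀ i, f i ≤ K) :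
    expectation (nextCenter X z) f ≤ K := by
  by_cases hs : ∑ i, ENNReal.ofReal (sqDist X z i) ≠ 0
  · have hsum : (∑ i, ENNReal.ofReal (sqDist X z i)) = ENNReal.ofReal (∑ i, sqDist X z i) :=
      (ENNReal.ofReal_sum_of_nonneg fun i _ => sqDist_nonneg X z i).symm
    have hpos : 0 < ∑ i, sqDist X z i := by
      rw [hsum, ENNReal.ofReal_ne_zero_iff] at hs
      exact hs
    have hp : ∀ i, (nextCenter X z i).toReal = (∑ i, sqDist X z i)⁻¹ * sqDist X z i := by
      intro i
      rw [nextCenter, dif_pos ⟨hm, hs⟩, PMF.normalize_apply, tsum_fintype, hsum, ENNReal.toReal_mul,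
        ENNReal.toReal_inv, ENNReal.toReal_ofReal hpos.le,
        ENNReal.toReal_ofReal (sqDist_nonneg X z i), mul_comm]
    simp only [expectation, hp, mul_assoc]
    rw [← Finset.mul_sum, inv_mul_le_iff₀ hpos]
    exact h
  · have hz : ∀ i, sqDist X z i = 0 := by
      intro i
      have := (Finset.sum_eq_zero_iff.1 (not_not.1 hs)) i (Finset.mem_univ i)
      exact le_antisymm (ENNReal.ofReal_eq_zero.1 this) (sqDist_nonneg X z i)
    calc expectation (nextCenter X z) f ≤ expectation (nextCenter X z) fun _ => K :=
          expectation_mono _ (h0 hz)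
      _ = K := by rw [expectation, ← Finset.sum_mul, sum_toReal_eq_one, one_mul]

/-- The clusters of `a` that contain none of the points listed by `z`. -/
def uncovered (a : Fin n → Fin k) (z : Fin m → Fin n) : Finset (Fin k) :=
  (Finset.univ.image fun l => a (z l))ᶜ

lemma uncovered_snoc (a : Fin n → Fin k) (z : Fin m → Fin n) (i : Fin n) :
    uncovered a (Fin.snoc z i : Fin (m + 1) → Fin n) = (uncovered a z).erase (a i) := by
  ext j
  simp only [uncovered, Finset.mem_compl, Finset.mem_image, Finset.mem_univ, true_and,
    Finset.mem_erase, Fin.exists_fin_succ', Fin.snoc_castSucc, Fin.snoc_last]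
  tauto

lemma le_card_uncovered (a : Fin n → Fin k) (z : Fin m → Fin n) :
    k - m ≤ (uncovered a z).card := by
  rw [uncovered, Finset.card_compl, Fintype.card_fin]
  have : (Finset.univ.image fun l => a (z l)).card ≤ m :=
    Finset.card_image_le.trans_eq (by simp)
  omega

variable [InnerProductSpace ℝ E]

/-- A bound for the expected potential after `t` more seeds, as a function of the seeds `z` chosen
so far: the covered clusters are charged their current potential and the uncovered ones eight times
their optimal cost, both up to a harmonic factor; a proportion of at least `(u - t) / u` of the `u`
uncovered clusters stays uncovered and is charged its current potential. -/
noncomputable def potentialBound (X : Fin n → E) (a : Fin n → Fin k) (t : ℕ) (z : Fin m → Fin n) : ℝ :=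
  (∑ j ∈ (uncovered a z)ᶜ, potential X a z j + 8 * ∑ j ∈ uncovered a z, clusterCost X a j) *
      (1 + (harmonic t : ℝ)) +
    (((uncovered a z).card : ℝ) - t) / ((uncovered a z).card : ℝ) *
      ∑ j ∈ uncovered a z, potential X a z j

lemma harmonic_cast_nonneg (t : ℕ) : (0 : ℝ) ≤ (harmonic t : ℝ) := by
  rw [harmonic]
  push_cast
  positivity

/-- The bound when the next seed lies in a covered cluster: nothing increases. -/
lemma potentialBound_snoc_le_of_notMem (X : Fin n → E) (a : Fin n → Fin k) (z : Fin m → Fin n)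
    (hm : m ≠ 0) {t : ℕ} (ht : t ≤ (uncovered a z).card) {i : Fin n} (hi : a i ∉ uncovered a z) :
    potentialBound X a t (Fin.snoc z i : Fin (m + 1) → Fin n) ≤ potentialBound X a t z := by
  have h : (t : ℝ) ≤ (uncovered a z).card := by exact_mod_cast ht
  have := harmonic_cast_nonneg t
  rw [potentialBound, potentialBound, uncovered_snoc, Finset.erase_eq_of_notMem hi]
  have hq : 0 ≤ (((uncovered a z).card : ℝ) - t) / ((uncovered a z).card : ℝ) :=
    div_nonneg (sub_nonneg.2 h) (Nat.cast_nonneg _)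
  gcongr <;> exact potential_snoc_le X a z hm i _

/-- The bound when the next seed lies in an uncovered cluster, which becomes covered. -/
lemma potentialBound_snoc_le_of_mem (X : Fin n → E) (a : Fin n → Fin k) (z : Fin m → Fin n)
    (hm : m ≠ 0) {t : ℕ} (ht : t + 1 ≤ (uncovered a z).card) {i : Fin n}
    (hi : a i ∈ uncovered a z) :
    potentialBound X a t (Fin.snoc z i : Fin (m + 1) → Fin n) ≤
      (∑ j ∈ (uncovered a z)ᶜ, potential X a z j + 8 * ∑ j ∈ uncovered a z, clusterCost X a j +
          (potential X a (Fin.snoc z i : Fin (m + 1) → Fin n) (a i) -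
            8 * clusterCost X a (a i))) * (1 + (harmonic t : ℝ)) +
        (((uncovered a z).card : ℝ) - 1 - t) / (((uncovered a z).card : ℝ) - 1) *
          (∑ j ∈ uncovered a z, potential X a z j - potential X a z (a i)) := by
  have h : (t : ℝ) + 1 ≤ (uncovered a z).card := by exact_mod_cast ht
  have := harmonic_cast_nonneg t
  have hu : (((uncovered a z).erase (a i)).card : ℝ) = (uncovered a z).card - 1 := by
    rw [Finset.card_erase_of_mem hi, Nat.cast_sub (by omega), Nat.cast_one]
  have hC : ∑ j ∈ (uncovered a z)ᶜ, potential X a (Fin.snoc z i : Fin (m + 1) → Fin n) j ≤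
      ∑ j ∈ (uncovered a z)ᶜ, potential X a z j :=
    Finset.sum_le_sum fun j _ => potential_snoc_le X a z hm i j
  have hU : ∑ j ∈ (uncovered a z).erase (a i),
      potential X a (Fin.snoc z i : Fin (m + 1) → Fin n) j ≤
      ∑ j ∈ (uncovered a z).erase (a i), potential X a z j :=
    Finset.sum_le_sum fun j _ => potential_snoc_le X a z hm i j
  have hcov : ((uncovered a z).erase (a i))ᶜ = insert (a i) (uncovered a z)ᶜ :=
    Finset.compl_erase
  rw [potentialBound, uncovered_snoc, hu, hcov, Finset.sum_insert (by simpa using hi)]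
  rw [Finset.sum_erase_eq_sub hi] at hU ⊢
  rw [Finset.sum_erase_eq_sub hi] at hU ⊢
  have hq : 0 ≤ (((uncovered a z).card : ℝ) - 1 - t) / (((uncovered a z).card : ℝ) - 1) :=
    div_nonneg (by linarith) (by linarith [(Nat.cast_nonneg t : (0 : ℝ) ≤ t)])
  refine add_le_add (mul_le_mul_of_nonneg_right ?_ (by linarith)) (mul_le_mul_of_nonneg_left hU hq)
  linarith

/-- The numerical inequality behind one step of the induction. Here `C`, `U` are the potentials of
the covered and of the uncovered clusters, `S` is the sum of the squares of the latter, and `O` is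
eight times the optimal cost of the uncovered clusters. -/
lemma potentialBound_step_ineq {C U O S H u t : ℝ} (hC : 0 ≤ C) (hU : 0 ≤ U) (hO : 0 ≤ O)
    (ht : 0 ≤ t) (hu : t + 1 ≤ u) (hS : U ^ 2 ≤ u * S) :
    C * ((C + O) * (1 + H) + (u - t) / u * U) +
        (U * ((C + O) * (1 + H)) + (u - 1 - t) / (u - 1) * (U ^ 2 - S)) ≤
      (C + U) * ((C + O) * (1 + (H + (t + 1)⁻¹)) + (u - (t + 1)) / u * U) := by
  have hu0 : 0 < u := by linarith
  have h1 : (u - 1 - t) / (u - 1) * (U ^ 2 - S) ≤ (u - (t + 1)) / u * U ^ 2 := by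
    rcases eq_or_lt_of_le (show 1 ≤ u by linarith) with h | h
    · subst h
      have : t = 0 := by linarith
      subst this
      simp
    · have hS' : U ^ 2 - S ≤ (u - 1) / u * U ^ 2 := by
        have : U ^ 2 / u ≤ S := by rwa [div_le_iff₀ hu0, mul_comm]
        have h2 : (u - 1) / u * U ^ 2 = U ^ 2 - U ^ 2 / u := by field_simp
        linarith
      have hq : 0 ≤ (u - 1 - t) / (u - 1) := div_nonneg (by linarith) (by linarith)
      refine (mul_le_mul_of_nonneg_left hS' hq).trans_eq ?_
      have : u - 1 ≠ 0 := by linarith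
      field_simp
      ring
  have h2 : C * U * u⁻¹ ≤ (C + U) * (C + O) * (t + 1)⁻¹ := by
    have : u⁻¹ ≤ (t + 1)⁻¹ := inv_anti₀ (by linarith) hu
    have h3 : C * U ≤ (C + U) * (C + O) := by nlinarith [mul_nonneg hU hO, mul_nonneg hC hO]
    exact mul_le_mul h3 this (inv_nonneg.2 hu0.le) (by positivity)
  have h3 : C * ((u - t) / u * U) = C * ((u - (t + 1)) / u * U) + C * U * u⁻¹ := by
    field_simp
    ring
  linear_combination h1 + h2 + h3

/-- The weighted sum over the candidates for the next seed, bounded cluster by cluster. -/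
lemma sum_sqDist_mul_potentialBound_snoc_le (X : Fin n → E) (a : Fin n → Fin k)
    (z : Fin m → Fin n) (hm : m ≠ 0) {t : ℕ} (ht : t + 1 ≤ (uncovered a z).card) :
    ∑ i, sqDist X z i * potentialBound X a t (Fin.snoc z i : Fin (m + 1) → Fin n) ≤
      (∑ i, sqDist X z i) * potentialBound X a (t + 1) z := by
  set W := uncovered a z with hW
  set C := ∑ j ∈ Wᶜ, potential X a z j with hC
  set U := ∑ j ∈ W, potential X a z j with hU
  set O := 8 * ∑ j ∈ W, clusterCost X a j with hO
  set u : ℝ := (W.card : ℝ) with hu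
  have hH := harmonic_cast_nonneg t
  set H : ℝ := (harmonic t : ℝ) with hHdef
  have hcov : ∀ j ∈ Wᶜ, ∑ i ∈ Finset.univ.filter (fun i => a i = j),
      sqDist X z i * potentialBound X a t (Fin.snoc z i : Fin (m + 1) → Fin n) ≤
      potential X a z j * ((C + O) * (1 + H) + (u - t) / u * U) := by
    intro j hj
    rw [potential, Finset.sum_mul]
    refine Finset.sum_le_sum fun i hi => mul_le_mul_of_nonneg_left ?_ (sqDist_nonneg _ _ _)
    refine potentialBound_snoc_le_of_notMem X a z hm ((Nat.le_succ t).trans ht) ?_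
    rw [(Finset.mem_filter.1 hi).2]
    exact Finset.mem_compl.1 hj
  have hunc : ∀ j ∈ W, ∑ i ∈ Finset.univ.filter (fun i => a i = j),
      sqDist X z i * potentialBound X a t (Fin.snoc z i : Fin (m + 1) → Fin n) ≤
      potential X a z j * ((C + O) * (1 + H)) +
        (u - 1 - t) / (u - 1) * (potential X a z j * U - potential X a z j ^ 2) := by
    intro j hj
    have h1 : ∀ i ∈ Finset.univ.filter (fun i => a i = j),
        sqDist X z i * potentialBound X a t (Fin.snoc z i : Fin (m + 1) → Fin n) ≤
        sqDist X z i * ((C + O - 8 * clusterCost X a j) * (1 + H) +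
          (u - 1 - t) / (u - 1) * (U - potential X a z j)) +
        sqDist X z i * potential X a (Fin.snoc z i : Fin (m + 1) → Fin n) j * (1 + H) := by
      intro i hi
      have hij := (Finset.mem_filter.1 hi).2
      have h2 := potentialBound_snoc_le_of_mem X a z hm ht (i := i) (by rwa [hij])
      rw [hij] at h2
      refine (mul_le_mul_of_nonneg_left h2 (sqDist_nonneg X z i)).trans_eq ?_
      ring
    refine (Finset.sum_le_sum h1).trans ?_
    rw [Finset.sum_add_distrib, ← Finset.sum_mul, ← Finset.sum_mul, ← potential]
    have h3 := mul_le_mul_of_nonneg_right (sum_sqDist_mul_potential_snoc_le X a z hm j)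
      (show 0 ≤ 1 + H by linarith)
    linear_combination h3
  have hsplit : ∑ i, sqDist X z i = C + U := by
    rw [← sum_potential X a z, hC, hU, add_comm, Finset.sum_add_sum_compl]
  have hstep : potentialBound X a (t + 1) z =
      (C + O) * (1 + (H + ((t : ℝ) + 1)⁻¹)) + (u - ((t : ℝ) + 1)) / u * U := by
    rw [potentialBound, harmonic_succ]
    push_cast
    rfl
  rw [hsplit, hstep, ← Finset.sum_fiberwise Finset.univ a, ← Finset.sum_compl_add_sum W]
  refine (add_le_add (Finset.sum_le_sum hcov) (Finset.sum_le_sum hunc)).trans ?_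
  rw [← Finset.sum_mul, Finset.sum_add_distrib, ← Finset.sum_mul, ← Finset.mul_sum,
    Finset.sum_sub_distrib, ← Finset.sum_mul, ← hC, ← hU, ← sq]
  refine potentialBound_step_ineq (Finset.sum_nonneg fun _ _ => potential_nonneg _ _ _ _)
    (Finset.sum_nonneg fun _ _ => potential_nonneg _ _ _ _)
    (mul_nonneg (by norm_num) (Finset.sum_nonneg fun _ _ => clusterCost_nonneg _ _ _))
    (Nat.cast_nonneg t) (by rw [hu]; exact_mod_cast ht) sq_sum_le_card_mul_sum_sq

/-- The bound does not increase on average when a seed is drawn and `t` is lowered by one. -/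
lemma expectation_nextCenter_potentialBound_le [NeZero n] (X : Fin n → E) (a : Fin n → Fin k)
    (z : Fin m → Fin n) (hm : m ≠ 0) {t : ℕ} (ht : t + 1 ≤ (uncovered a z).card) :
    expectation (nextCenter X z)
        (fun i => potentialBound X a t (Fin.snoc z i : Fin (m + 1) → Fin n)) ≤
      potentialBound X a (t + 1) z := by
  refine expectation_nextCenter_le X z hm _ _
    (sum_sqDist_mul_potentialBound_snoc_le X a z hm ht) fun h0 i => ?_
  have hp : ∀ j, potential X a z j = 0 := fun j => Finset.sum_eq_zero fun i _ => h0 i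
  have hp' : ∀ j, potential X a (Fin.snoc z i : Fin (m + 1) → Fin n) j = 0 := fun j =>
    le_antisymm ((potential_snoc_le X a z hm i j).trans_eq (hp j)) (potential_nonneg _ _ _ _)
  have hH := harmonic_cast_nonneg t
  have hsub : ∑ j ∈ (uncovered a z).erase (a i), clusterCost X a j ≤
      ∑ j ∈ uncovered a z, clusterCost X a j :=
    Finset.sum_le_sum_of_subset_of_nonneg (Finset.erase_subset _ _)
      fun _ _ _ => clusterCost_nonneg _ _ _
  have hnn : 0 ≤ ∑ j ∈ uncovered a z, clusterCost X a j :=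
    Finset.sum_nonneg fun _ _ => clusterCost_nonneg _ _ _
  have hharm : (harmonic t : ℝ) ≤ (harmonic (t + 1) : ℝ) := by
    rw [harmonic_succ]
    push_cast
    have : (0 : ℝ) ≤ ((t : ℝ) + 1)⁻¹ := by positivity
    linarith
  simp only [potentialBound, hp, hp', uncovered_snoc, Finset.sum_const_zero, mul_zero, add_zero,
    zero_add]
  gcongr

lemma expectation_seeding_potentialBound_le [NeZero n] (X : Fin n → E) (a : Fin n → Fin k) :
    ∀ m, 1 ≤ m → m ≤ k → expectation (seeding X m) (potentialBound X a (k - m)) ≤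
      expectation (seeding X 1) (potentialBound X a (k - 1)) := by
  intro m hm
  induction m, hm using Nat.le_induction with
  | base => exact fun _ => le_rfl
  | succ m hm ih =>
    intro hk
    refine le_trans ?_ (ih (by omega))
    rw [expectation_seeding_succ]
    refine expectation_mono _ fun z => ?_
    have hsub : k - m = k - (m + 1) + 1 := by omega
    rw [hsub]
    exact expectation_nextCenter_potentialBound_le X a z (by omega)
      (by rw [← hsub]; exact le_card_uncovered a z)

/-- After the first seed exactly `k - 1` clusters are uncovered, so that only the harmonic part of
the bound remains. -/
lemma expectation_seeding_one_potentialBound_le [NeZero n] (X : Fin n → E) (a : Fin n → Fin k) :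
    expectation (seeding X 1) (potentialBound X a (k - 1)) ≤
      8 * (1 + (harmonic (k - 1) : ℝ)) * ∑ j, clusterCost X a j := by
  have hH := harmonic_cast_nonneg (k - 1)
  have hn : (0 : ℝ) < n := by exact_mod_cast Nat.pos_of_ne_zero (NeZero.ne n)
  set z : Fin 0 → Fin n := Fin.elim0 with hz
  set T := ∑ j, clusterCost X a j with hT
  have hval : ∀ i, potentialBound X a (k - 1) (Fin.snoc z i : Fin 1 → Fin n) =
      (potential X a (Fin.snoc z i : Fin 1 → Fin n) (a i) + 8 * (T - clusterCost X a (a i))) *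
        (1 + (harmonic (k - 1) : ℝ)) := by
    intro i
    have hk : 1 ≤ k := (Nat.zero_le _).trans_lt (a i).2
    have hunc : uncovered a (Fin.snoc z i : Fin 1 → Fin n) = Finset.univ.erase (a i) := by
      rw [uncovered_snoc]
      congr 1
    have hcard : ((Finset.univ.erase (a i)).card : ℝ) = ((k - 1 : ℕ) : ℝ) := by
      rw [Finset.card_erase_of_mem (Finset.mem_univ _), Finset.card_univ, Fintype.card_fin]
    rw [potentialBound, hunc, hcard, Finset.compl_erase, Finset.compl_univ,
      Finset.sum_erase_eq_sub (Finset.mem_univ _)]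
    simp [hT]
  have hsum : ∑ i, potential X a (Fin.snoc z i : Fin 1 → Fin n) (a i) ≤
      ∑ i, 2 * clusterCost X a (a i) := by
    rw [← Finset.sum_fiberwise Finset.univ a, ← Finset.sum_fiberwise Finset.univ a]
    refine Finset.sum_le_sum fun j _ => ?_
    calc _ = ∑ i ∈ Finset.univ.filter (fun i => a i = j),
          potential X a (Fin.snoc z i : Fin 1 → Fin n) j :=
          Finset.sum_congr rfl fun i hi => by rw [(Finset.mem_filter.1 hi).2]
      _ ≤ _ := sum_potential_snoc_le X a z j
      _ = ∑ i ∈ Finset.univ.filter (fun i => a i = j), 2 * clusterCost X a j := by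
          rw [Finset.sum_const, nsmul_eq_mul]
          ring
      _ = _ := Finset.sum_congr rfl fun i hi => by rw [(Finset.mem_filter.1 hi).2]
  have hle : ∑ i, (potential X a (Fin.snoc z i : Fin 1 → Fin n) (a i) +
      8 * (T - clusterCost X a (a i))) ≤ n * (8 * T) := by
    have hpos : 0 ≤ ∑ i, clusterCost X a (a i) :=
      Finset.sum_nonneg fun _ _ => clusterCost_nonneg _ _ _
    rw [Finset.sum_add_distrib, ← Finset.mul_sum, Finset.sum_sub_distrib, Finset.sum_const,
      Finset.card_univ, Fintype.card_fin, nsmul_eq_mul]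
    rw [← Finset.mul_sum] at hsum
    linarith
  rw [expectation_seeding_succ, seeding, expectation_pure, expectation_nextCenter_zero]
  simp only [← hz, hval]
  rw [← Finset.sum_mul, inv_mul_le_iff₀ hn]
  refine (mul_le_mul_of_nonneg_right hle (by linarith)).trans_eq ?_
  ring

/-- The theorem of Arthur and Vassilvitskii on the k-means++ seeding: the expected `D²` potential
exceeds the cost of any clustering into `k` clusters by at most the factor `8 (log k + 2)`. -/
theorem expectation_seeding_sum_sqDist_le [NeZero n] (hk : 1 ≤ k) (X : Fin n → E)
    (a : Fin n → Fin k) :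
    expectation (seeding X k) (fun z => ∑ i, sqDist X z i) ≤
      8 * (Real.log k + 2) * ∑ j, clusterCost X a j := by
  have hbound : ∀ z : Fin k → Fin n, ∑ i, sqDist X z i ≤ potentialBound X a (k - k) z := by
    intro z
    have h8 : 0 ≤ 8 * ∑ j ∈ uncovered a z, clusterCost X a j :=
      mul_nonneg (by norm_num) (Finset.sum_nonneg fun _ _ => clusterCost_nonneg _ _ _)
    rw [← sum_potential X a, ← Finset.sum_compl_add_sum (uncovered a z), Nat.sub_self,
      potentialBound, harmonic_zero]
    rcases (uncovered a z).eq_empty_or_nonempty with h | h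
    · simp [h]
    · have hc : ((uncovered a z).card : ℝ) ≠ 0 := by exact_mod_cast h.card_pos.ne'
      simp only [Rat.cast_zero, add_zero, mul_one, Nat.cast_zero, sub_zero, div_self hc, one_mul]
      linarith
  have hharm : (harmonic (k - 1) : ℝ) ≤ 1 + Real.log k := by
    refine (harmonic_le_one_add_log (k - 1)).trans ?_
    rcases Nat.eq_zero_or_pos (k - 1) with h | h
    · rw [h]
      simpa using Real.log_nonneg (by exact_mod_cast hk : (1 : ℝ) ≤ k)
    · have : ((k - 1 : ℕ) : ℝ) ≤ k := by exact_mod_cast Nat.sub_le k 1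
      have := Real.log_le_log (by exact_mod_cast h) this
      linarith
  have hnn : 0 ≤ ∑ j, clusterCost X a j := Finset.sum_nonneg fun _ _ => clusterCost_nonneg _ _ _
  calc _ ≤ expectation (seeding X k) (potentialBound X a (k - k)) := expectation_mono _ hbound
    _ ≤ _ := expectation_seeding_potentialBound_le X a k hk le_rfl
    _ ≤ _ := expectation_seeding_one_potentialBound_le X a
    _ ≤ _ := by
      refine mul_le_mul_of_nonneg_right ?_ hnn
      linarith

end Potential

/-! ### Best approximation of bounded rank of a symmetric operator -/

section EckartYoung

variable {E : Type*} [NormedAddCommGroup E] [InnerProductSpace ℝ E] {ι κ : Type*}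

/-- Pythagoras for the projection to the span of an orthonormal family. -/
lemma sq_norm_sub_sum_inner [Fintype ι] {v : ι → E} (hv : Orthonormal ℝ v) (x : E) :
    ‖x - ∑ i, inner ℝ (v i) x • v i‖ ^ 2 = ‖x‖ ^ 2 - ∑ i, inner ℝ (v i) x ^ 2 := by
  have h1 : inner ℝ x (∑ i, inner ℝ (v i) x • v i) = ∑ i, inner ℝ (v i) x ^ 2 := by
    rw [inner_sum]
    refine Finset.sum_congr rfl fun i _ => ?_
    rw [real_inner_smul_right, real_inner_comm x (v i), sq]
  have h2 : ‖∑ i, inner ℝ (v i) x • v i‖ ^ 2 = ∑ i, inner ℝ (v i) x ^ 2 := by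
    rw [← real_inner_self_eq_norm_sq, hv.inner_sum]
    exact Finset.sum_congr rfl fun i _ => by simp [sq]
  rw [norm_sub_sq_real, h1, h2]
  ring

lemma inner_sub_sum_inner [Fintype ι] {v : ι → E} (hv : Orthonormal ℝ v) (x : E) (i : ι) :
    inner ℝ (v i) (x - ∑ i, inner ℝ (v i) x • v i) = 0 := by
  rw [inner_sub_right, hv.inner_right_fintype, sub_self]

/-- On the orthogonal complement of the chosen eigenvectors, a symmetric operator is bounded by
each of the chosen eigenvalues: its eigenvectors there are eigenvectors of the whole operator. -/
lemma sq_norm_apply_le_of_orthogonal [FiniteDimensional ℝ E] {T : E →ₗ[ℝ] E} (hT : T.IsSymmetric)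
    {v : ι → E} {lam : ι → ℝ} (hTv : ∀ i, T (v i) = lam i • v i) {c : ℝ}
    (htop : ∀ (μ : ℝ) (x : E), x ≠ 0 → T x = μ • x → (∀ i, inner ℝ (v i) x = 0) → |μ| ≤ |c|)
    {w : E} (hw : ∀ i, inner ℝ (v i) w = 0) :
    ‖T w‖ ^ 2 ≤ c ^ 2 * ‖w‖ ^ 2 := by
  set K : Submodule ℝ E := (Submodule.span ℝ (Set.range v))ᗮ with hK
  have hmem : ∀ x, x ∈ K ↔ ∀ i, inner ℝ (v i) x = 0 := by
    intro x
    constructor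
    · intro hx i
      exact hx _ (Submodule.subset_span ⟨i, rfl⟩)
    · intro h u hu
      induction hu using Submodule.span_induction with
      | mem u hu =>
        obtain ⟨i, rfl⟩ := hu
        exact h i
      | zero => simp
      | add a b _ _ ha hb => rw [inner_add_left, ha, hb, add_zero]
      | smul r a _ ha => rw [real_inner_smul_left, ha, mul_zero]
  have hinv : ∀ x ∈ K, T x ∈ K := by
    intro x hx
    rw [hmem] at hx ⊢
    intro i
    rw [← hT, hTv, real_inner_smul_left, hx, mul_zero]
  have hsymm : (T.restrict hinv).IsSymmetric := hT.restrict_invariant hinv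
  set b := hsymm.eigenvectorBasis rfl with hb
  set x : K := ⟨w, (hmem w).2 hw⟩ with hx
  have heig : ∀ l, hsymm.eigenvalues rfl l ^ 2 ≤ c ^ 2 := by
    intro l
    have h1 := hsymm.apply_eigenvectorBasis rfl l
    refine sq_le_sq.2 (htop _ (b l : E) ?_ ?_ ((hmem _).1 (b l).2))
    · have := b.orthonormal.ne_zero l
      simpa using this
    · exact congrArg Subtype.val h1
  have hnorm : ‖T w‖ ^ 2 = ∑ l, (hsymm.eigenvalues rfl l * inner ℝ (b l) x) ^ 2 := by
    have h1 : ‖T w‖ = ‖T.restrict hinv x‖ := rfl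
    rw [h1, ← b.sum_sq_inner_right]
    refine Finset.sum_congr rfl fun l _ => ?_
    rw [← hsymm, hsymm.apply_eigenvectorBasis, real_inner_smul_left]
    rfl
  have hnorm' : ‖w‖ ^ 2 = ∑ l, inner ℝ (b l) x ^ 2 := by
    rw [b.sum_sq_inner_right]
    rfl
  rw [hnorm, hnorm', Finset.mul_sum]
  refine Finset.sum_le_sum fun l _ => ?_
  rw [mul_pow]
  exact mul_le_mul_of_nonneg_right (heig l) (sq_nonneg _)

/-- A maximum principle of Ky Fan: at most `d` orthonormal vectors do not capture more of a
symmetric operator than `d` eigenvectors for eigenvalues of largest absolute value. -/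
lemma sum_sq_norm_apply_le [FiniteDimensional ℝ E] [Fintype κ] {d : ℕ} {T : E →ₗ[ℝ] E}
    (hT : T.IsSymmetric) {v : Fin d → E} (hv : Orthonormal ℝ v) {lam : Fin d → ℝ}
    (hTv : ∀ i, T (v i) = lam i • v i) (hanti : Antitone fun i => |lam i|)
    (htop : ∀ (μ : ℝ) (x : E), x ≠ 0 → T x = μ • x → (∀ i, inner ℝ (v i) x = 0) →
      ∀ i, |μ| ≤ |lam i|)
    {q : κ → E} (hq : Orthonormal ℝ q) (hcard : Fintype.card κ ≤ d) :
    ∑ l, ‖T (q l)‖ ^ 2 ≤ ∑ i, lam i ^ 2 := by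
  rcases Nat.eq_zero_or_pos d with rfl | hd
  · have : IsEmpty κ := Fintype.card_eq_zero_iff.1 (by omega)
    simp
  set c := lam ⟨d - 1, by omega⟩ with hc
  have hmin : ∀ i, c ^ 2 ≤ lam i ^ 2 := fun i =>
    sq_le_sq.2 (hanti (Fin.le_def.2 (show (i : ℕ) ≤ d - 1 by omega)))
  have hpoint : ∀ l, ‖T (q l)‖ ^ 2 ≤
      c ^ 2 + ∑ i, (lam i ^ 2 - c ^ 2) * inner ℝ (v i) (q l) ^ 2 := by
    intro l
    have h1 : ∀ i, inner ℝ (v i) (T (q l)) = lam i * inner ℝ (v i) (q l) := fun i => by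
      rw [← hT, hTv, real_inner_smul_left]
    -- the projection away from the eigenvectors commutes with `T`
    have h2 : T (q l) - ∑ i, inner ℝ (v i) (T (q l)) • v i =
        T (q l - ∑ i, inner ℝ (v i) (q l) • v i) := by
      rw [map_sub, map_sum]
      congr 1
      refine Finset.sum_congr rfl fun i _ => ?_
      rw [map_smul, hTv, h1, smul_smul, mul_comm]
    have h3 := sq_norm_sub_sum_inner hv (T (q l))
    have h4 := sq_norm_apply_le_of_orthogonal hT hTv (c := c)
      (fun μ x hx hTx hxv => htop μ x hx hTx hxv _) (inner_sub_sum_inner hv (q l))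
    rw [sq_norm_sub_sum_inner hv (q l), hq.1 l] at h4
    rw [h2] at h3
    simp only [h1, mul_pow] at h3
    simp only [sub_mul, Finset.sum_sub_distrib, ← Finset.mul_sum]
    linarith
  have hbessel : ∀ i, ∑ l, inner ℝ (v i) (q l) ^ 2 ≤ 1 := by
    intro i
    have h1 := hq.sum_inner_products_le (v i) (s := Finset.univ)
    rw [hv.1 i] at h1
    simpa [real_inner_comm] using h1
  calc ∑ l, ‖T (q l)‖ ^ 2
      ≤ ∑ l, (c ^ 2 + ∑ i, (lam i ^ 2 - c ^ 2) * inner ℝ (v i) (q l) ^ 2) :=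
        Finset.sum_le_sum fun l _ => hpoint l
    _ = Fintype.card κ * c ^ 2 +
          ∑ i, (lam i ^ 2 - c ^ 2) * ∑ l, inner ℝ (v i) (q l) ^ 2 := by
        rw [Finset.sum_add_distrib, Finset.sum_const, nsmul_eq_mul, Finset.card_univ,
          Finset.sum_comm]
        simp only [Finset.mul_sum]
    _ ≤ d * c ^ 2 + ∑ i, (lam i ^ 2 - c ^ 2) * 1 := by
        refine add_le_add (mul_le_mul_of_nonneg_right (by exact_mod_cast hcard) (sq_nonneg _))
          (Finset.sum_le_sum fun i _ => mul_le_mul_of_nonneg_left (hbessel i) ?_)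
        exact sub_nonneg.2 (hmin i)
    _ = ∑ i, lam i ^ 2 := by
        simp [Finset.sum_sub_distrib]

/-- The Eckart–Young theorem for symmetric operators, with the Hilbert–Schmidt norm written out in
the orthonormal basis `e`. -/
theorem sum_sq_norm_sub_truncation_le [FiniteDimensional ℝ E] [Fintype ι] {d : ℕ}
    (e : OrthonormalBasis ι ℝ E) {T : E →ₗ[ℝ] E} (hT : T.IsSymmetric) {v : Fin d → E}
    (hv : Orthonormal ℝ v) {lam : Fin d → ℝ} (hTv : ∀ i, T (v i) = lam i • v i)
    (hanti : Antitone fun i => |lam i|)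
    (htop : ∀ (μ : ℝ) (x : E), x ≠ 0 → T x = μ • x → (∀ i, inner ℝ (v i) x = 0) →
      ∀ i, |μ| ≤ |lam i|)
    (S : E →ₗ[ℝ] E) (hS : Module.finrank ℝ (LinearMap.range S) ≤ d) :
    ∑ j, ‖T (e j) - ∑ i, (lam i * inner ℝ (v i) (e j)) • v i‖ ^ 2 ≤
      ∑ j, ‖T (e j) - S (e j)‖ ^ 2 := by
  have hparseval : ∀ x, ∑ j, inner ℝ x (T (e j)) ^ 2 = ‖T x‖ ^ 2 := by
    intro x
    rw [← e.sum_sq_inner_left]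
    exact Finset.sum_congr rfl fun j _ => by rw [hT]
  have hleft : ∑ j, ‖T (e j) - ∑ i, (lam i * inner ℝ (v i) (e j)) • v i‖ ^ 2 =
      ∑ j, ‖T (e j)‖ ^ 2 - ∑ i, lam i ^ 2 := by
    have h1 : ∀ j i, lam i * inner ℝ (v i) (e j) = inner ℝ (v i) (T (e j)) := fun j i => by
      rw [← hT, hTv, real_inner_smul_left]
    simp only [h1, sq_norm_sub_sum_inner hv]
    rw [Finset.sum_sub_distrib, Finset.sum_comm]
    congr 1
    refine Finset.sum_congr rfl fun i _ => ?_
    rw [hparseval, hTv, norm_smul, hv.1 i, mul_one, Real.norm_eq_abs, sq_abs]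
  set b := stdOrthonormalBasis ℝ (LinearMap.range S) with hb
  set q : Fin (Module.finrank ℝ (LinearMap.range S)) → E := fun l => (b l : E) with hq
  have hqo : Orthonormal ℝ q := b.orthonormal.comp_linearIsometry (LinearMap.range S).subtypeₗᵢ
  have hright : ∑ j, ‖T (e j)‖ ^ 2 - ∑ l, ‖T (q l)‖ ^ 2 ≤ ∑ j, ‖T (e j) - S (e j)‖ ^ 2 := by
    have h1 : ∑ l, ‖T (q l)‖ ^ 2 = ∑ j, ∑ l, inner ℝ (q l) (T (e j)) ^ 2 := by
      rw [Finset.sum_comm]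
      exact Finset.sum_congr rfl fun l _ => (hparseval _).symm
    rw [h1, ← Finset.sum_sub_distrib]
    refine Finset.sum_le_sum fun j _ => ?_
    have h2 : ∑ l, inner ℝ (q l) (S (e j)) • q l = S (e j) := by
      have h3 := congrArg (LinearMap.range S).subtype
        (b.sum_repr' ⟨S (e j), LinearMap.mem_range_self S (e j)⟩)
      rw [map_sum] at h3
      exact h3
    have h4 : T (e j) - ∑ l, inner ℝ (q l) (T (e j)) • q l =
        (T (e j) - S (e j)) - ∑ l, inner ℝ (q l) (T (e j) - S (e j)) • q l := by
      simp only [inner_sub_right, sub_smul, Finset.sum_sub_distrib, h2]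
      abel
    rw [← sq_norm_sub_sum_inner hqo, h4, sq_norm_sub_sum_inner hqo]
    have : 0 ≤ ∑ l, inner ℝ (q l) (T (e j) - S (e j)) ^ 2 :=
      Finset.sum_nonneg fun _ _ => sq_nonneg _
    linarith
  have hky := sum_sq_norm_apply_le hT hv hTv hanti htop hqo (by simpa using hS)
  rw [hleft]
  linarith

end EckartYoung

/-! ### Frobenius norms -/

section Frobenius

variable {n d k : ℕ}

lemma sq_frobenius_norm {l m : Type*} [Fintype l] [Fintype m] (A : Matrix l m ℝ) :
    ‖A‖ ^ 2 = ∑ i, ∑ j, A i j ^ 2 := by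
  have h : 0 ≤ ∑ i, ∑ j, A i j ^ 2 :=
    Finset.sum_nonneg fun _ _ => Finset.sum_nonneg fun _ _ => sq_nonneg _
  rw [Matrix.frobenius_norm_def, ← Real.sqrt_eq_rpow]
  simp only [Real.rpow_two, Real.norm_eq_abs, sq_abs]
  exact Real.sq_sqrt h

lemma sq_frobenius_norm_eq_sum_rows (A : Matrix (Fin n) (Fin d) ℝ) :
    ‖A‖ ^ 2 = ∑ i, ‖rows A i‖ ^ 2 := by
  rw [sq_frobenius_norm]
  exact Finset.sum_congr rfl fun i _ => by simp [EuclideanSpace.norm_sq_eq, rows]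

lemma sq_frobenius_norm_eq_sum_columns (A : Matrix (Fin n) (Fin n) ℝ) :
    ‖A‖ ^ 2 = ∑ j, ‖Matrix.toEuclideanLin A (EuclideanSpace.basisFun (Fin n) ℝ j)‖ ^ 2 := by
  rw [sq_frobenius_norm, Finset.sum_comm]
  exact Finset.sum_congr rfl fun j _ => by
    simp [EuclideanSpace.norm_sq_eq, Matrix.toLpLin_apply, Matrix.mulVec_single]

lemma rows_replaceRows (U : Matrix (Fin n) (Fin d) ℝ) (a : Fin n → Fin k) (i : Fin n) :
    rows (replaceRows U a) i = centroid (rows U) a (a i) := rfl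

lemma sq_norm_sub_replaceRows (U : Matrix (Fin n) (Fin d) ℝ) (a : Fin n → Fin k) :
    ‖U - replaceRows U a‖ ^ 2 = ∑ j, clusterCost (rows U) a j := by
  rw [sq_frobenius_norm_eq_sum_rows, sum_clusterCost]
  rfl

lemma norm_replaceRows_le (U : Matrix (Fin n) (Fin d) ℝ) (a : Fin n → Fin k) :
    ‖replaceRows U a‖ ≤ ‖U‖ := by
  refine le_of_sq_le_sq ?_ (norm_nonneg _)
  rw [sq_frobenius_norm_eq_sum_rows, sq_frobenius_norm_eq_sum_rows,
    ← Finset.sum_fiberwise Finset.univ a, ← Finset.sum_fiberwise Finset.univ a]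
  refine Finset.sum_le_sum fun j _ => ?_
  have h1 := sum_sq_norm_sub_eq (rows U) a j 0
  have h2 := clusterCost_nonneg (rows U) a j
  have h3 : ∑ i ∈ Finset.univ.filter (fun i => a i = j), ‖rows (replaceRows U a) i‖ ^ 2 =
      ((Finset.univ.filter fun i => a i = j).card : ℝ) * ‖centroid (rows U) a j‖ ^ 2 := by
    rw [← nsmul_eq_mul, ← Finset.sum_const]
    refine Finset.sum_congr rfl fun i hi => ?_
    rw [rows_replaceRows, (Finset.mem_filter.1 hi).2]
  simp only [sub_zero] at h1
  rw [h3]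
  linarith

lemma norm_mul_signs_le (M : Matrix (Fin n) (Fin d) ℝ) (lam : Fin d → ℝ) :
    ‖M * signs lam‖ ≤ ‖M‖ := by
  refine le_of_sq_le_sq ?_ (norm_nonneg _)
  rw [sq_frobenius_norm, sq_frobenius_norm]
  refine Finset.sum_le_sum fun i _ => Finset.sum_le_sum fun j _ => ?_
  rw [signs, Matrix.mul_diagonal, mul_pow]
  rcases Real.sign_apply_eq (lam j) with h | h | h <;> rw [h] <;> nlinarith [sq_nonneg (M i j)]

lemma sq_norm_rescaled (lam : Fin d → ℝ) {V : Matrix (Fin n) (Fin d) ℝ} (hV : Vᵀ * V = 1) :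
    ‖rescaled lam V‖ ^ 2 = ∑ i, |lam i| := by
  rw [sq_frobenius_norm, Finset.sum_comm]
  refine Finset.sum_congr rfl fun j _ => ?_
  have h : ∑ i, V i j ^ 2 = 1 := by
    have := congrFun (congrFun hV j) j
    rw [Matrix.mul_apply, Matrix.one_apply_eq] at this
    simpa [sq] using this
  simp only [rescaled, Matrix.mul_diagonal, mul_pow, Real.sq_sqrt (abs_nonneg _)]
  rw [← Finset.sum_mul, h, one_mul]

lemma rescaled_mul_signs_mul_transpose (lam : Fin d → ℝ) (V : Matrix (Fin n) (Fin d) ℝ) :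
    rescaled lam V * signs lam * (rescaled lam V)ᵀ = V * Matrix.diagonal lam * Vᵀ := by
  have h : ∀ x : ℝ, √|x| * (Real.sign x * √|x|) = x := fun x => by
    rw [mul_left_comm, Real.mul_self_sqrt (abs_nonneg x)]
    rcases lt_trichotomy x 0 with h | h | h
    · rw [Real.sign_of_neg h, abs_of_neg h]
      ring
    · simp [h]
    · rw [Real.sign_of_pos h, abs_of_pos h, one_mul]
  rw [rescaled, signs, Matrix.transpose_mul, Matrix.diagonal_transpose, Matrix.mul_assoc V,
    Matrix.diagonal_mul_diagonal, Matrix.mul_assoc V, ← Matrix.mul_assoc (Matrix.diagonal _),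
    Matrix.diagonal_mul_diagonal, ← Matrix.mul_assoc]
  simp only [mul_assoc, h]

/-- Replacing `U` by `U_c` in `U S Uᵀ` one factor at a time. -/
lemma norm_truncation_sub_blockApprox_le (lam : Fin d → ℝ) (V : Matrix (Fin n) (Fin d) ℝ)
    (a : Fin n → Fin k) :
    ‖V * Matrix.diagonal lam * Vᵀ - blockApprox lam V a‖ ≤
      2 * ‖rescaled lam V‖ * ‖rescaled lam V - replaceRows (rescaled lam V) a‖ := by
  rw [← rescaled_mul_signs_mul_transpose, blockApprox]
  set U := rescaled lam V
  set W := replaceRows U a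
  have hsplit : U * signs lam * Uᵀ - W * signs lam * Wᵀ =
      (U - W) * signs lam * Uᵀ + W * signs lam * (U - W)ᵀ := by
    rw [Matrix.transpose_sub, Matrix.sub_mul, Matrix.sub_mul, Matrix.mul_sub]
    abel
  have hbound : ∀ M N : Matrix (Fin n) (Fin d) ℝ, ‖M * signs lam * Nᵀ‖ ≤ ‖M‖ * ‖N‖ :=
    fun M N => (Matrix.frobenius_norm_mul _ _).trans <| by
      rw [Matrix.frobenius_norm_transpose]
      exact mul_le_mul_of_nonneg_right (norm_mul_signs_le M lam) (norm_nonneg _)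
  have hW : ‖W‖ ≤ ‖U‖ := norm_replaceRows_le U a
  rw [hsplit]
  refine (norm_add_le _ _).trans ((add_le_add (hbound _ _) (hbound _ _)).trans ?_)
  nlinarith [norm_nonneg (U - W)]

/-- The Eckart–Young theorem for symmetric matrices. -/
theorem norm_sub_truncation_le {F : Matrix (Fin n) (Fin n) ℝ} (hF : F.IsSymm) {lam : Fin d → ℝ}
    {V : Matrix (Fin n) (Fin d) ℝ} (h : IsTopEigenpairs F lam V) (B : Matrix (Fin n) (Fin n) ℝ)
    (hB : B.rank ≤ d) :
    ‖F - V * Matrix.diagonal lam * Vᵀ‖ ≤ ‖F - B‖ := by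
  set v : Fin d → EuclideanSpace ℝ (Fin n) := fun i => WithLp.toLp 2 fun a => V a i with hv
  set e := EuclideanSpace.basisFun (Fin n) ℝ with he
  have hT : (Matrix.toEuclideanLin F).IsSymmetric := by
    rw [Matrix.isSymmetric_toEuclideanLin_iff, Matrix.IsHermitian,
      Matrix.conjTranspose_eq_transpose_of_trivial]
    exact hF
  have hinner : ∀ i (x : EuclideanSpace ℝ (Fin n)), inner ℝ (v i) x = (Vᵀ *ᵥ x.ofLp) i := by
    intro i x
    simp [hv, PiLp.inner_apply, Matrix.mulVec, dotProduct, mul_comm]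
  have hvo : Orthonormal ℝ v := by
    rw [orthonormal_iff_ite]
    intro i j
    rw [hinner, ← Matrix.one_apply, ← h.orthonormal]
    rfl
  have hTv : ∀ i, Matrix.toEuclideanLin F (v i) = lam i • v i := by
    intro i
    ext a
    have h1 := congrFun (congrFun h.eigen a) i
    rw [Matrix.mul_diagonal] at h1
    simp only [hv, Matrix.toLpLin_apply, PiLp.smul_apply, smul_eq_mul]
    rw [mul_comm, ← h1]
    rfl
  have htop : ∀ (μ : ℝ) (x : EuclideanSpace ℝ (Fin n)), x ≠ 0 →
      Matrix.toEuclideanLin F x = μ • x → (∀ i, inner ℝ (v i) x = 0) → ∀ i, |μ| ≤ |lam i| := by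
    intro μ x hx hTx hvx
    refine h.top μ x.ofLp (fun h0 => hx ?_) ?_ ?_
    · ext a
      exact congrFun h0 a
    · exact congrArg WithLp.ofLp hTx
    · ext i
      rw [← hinner]
      exact hvx i
  have hrank : Module.finrank ℝ (LinearMap.range (Matrix.toEuclideanLin B)) ≤ d := by
    rwa [Matrix.rank_eq_finrank_range_toLin B (PiLp.basisFun 2 ℝ _) (PiLp.basisFun 2 ℝ _),
      ← Matrix.toLpLin_eq_toLin] at hB
  have hey := sum_sq_norm_sub_truncation_le e hT hvo hTv h.sorted htop _ hrank
  refine le_of_sq_le_sq ?_ (norm_nonneg _)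
  rw [sq_frobenius_norm_eq_sum_columns, sq_frobenius_norm_eq_sum_columns, ← he]
  simp only [map_sub, LinearMap.sub_apply]
  refine le_trans (le_of_eq ?_) hey
  refine Finset.sum_congr rfl fun j _ => ?_
  congr 3
  ext a
  have hcoef : ∀ i, inner ℝ (v i) (e j) = V j i := fun i => by
    rw [hinner]
    simp [he]
  have hcol : ∀ M : Matrix (Fin n) (Fin n) ℝ, Matrix.toEuclideanLin M (e j) a = M a j := fun M => by
    simp [he, Matrix.toLpLin_apply]
  simp only [hcoef]
  rw [hcol, Matrix.mul_apply]
  simp only [Matrix.mul_diagonal, WithLp.ofLp_sum, Finset.sum_apply, PiLp.smul_apply,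
    smul_eq_mul, Matrix.transpose_apply, hv]
  exact Finset.sum_congr rfl fun i _ => by ring

end Frobenius

/-! ### The expected error of the block approximation -/

lemma exists_phiOpt_eq {n d k : ℕ} (hk : 1 ≤ k) (U : Matrix (Fin n) (Fin d) ℝ) :
    ∃ a : Fin n → Fin k, ‖U - replaceRows U a‖ = phiOpt U k :=
  have : Nonempty (Fin k) := ⟨⟨0, hk⟩⟩
  exists_eq_ciInf_of_finite

/-- The expected objective of a run of k-means++. As `1 ≤ 8 (log k + 2)`, no square root of this
factor is taken. -/
theorem expectation_norm_sub_replaceRows_le {n d k : ℕ} [NeZero n] (hk : 1 ≤ k)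
    (U : Matrix (Fin n) (Fin d) ℝ) {A : (Fin k → Fin n) → (Fin n → Fin k)}
    (hA : IsKMeansRun U A) :
    expectation (seeding (rows U) k) (fun z => ‖U - replaceRows U (A z)‖) ≤
      8 * (Real.log k + 2) * phiOpt U k := by
  obtain ⟨a, ha⟩ := exists_phiOpt_eq hk U
  have hlog : 0 ≤ Real.log k := Real.log_nonneg (by exact_mod_cast hk)
  rw [← ha]
  refine le_of_sq_le_sq ?_ (by positivity)
  calc _ ≤ expectation (seeding (rows U) k) (fun z => ‖U - replaceRows U (A z)‖ ^ 2) :=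
        sq_expectation_le _ fun _ => norm_nonneg _
    _ ≤ expectation (seeding (rows U) k) (fun z => ∑ i, sqDist (rows U) z i) :=
        expectation_mono _ fun z => by
          rw [sq_norm_sub_replaceRows]
          exact (hA z).sum_clusterCost_le_sum_sqDist hk
    _ ≤ 8 * (Real.log k + 2) * ‖U - replaceRows U a‖ ^ 2 := by
        rw [sq_norm_sub_replaceRows]
        exact expectation_seeding_sum_sqDist_le hk _ a
    _ ≤ (8 * (Real.log k + 2) * ‖U - replaceRows U a‖) ^ 2 := by
        rw [mul_pow]
        refine mul_le_mul_of_nonneg_right ?_ (sq_nonneg _)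
        nlinarith

end SpectralBlock

theorem proposition1 :
    ∃ g : ℕ → ℝ, g =O[atTop] (fun k : ℕ => Real.log (k : ℝ)) ∧
      ∀ (n d k : ℕ) [NeZero n], 1 ≤ k →
      ∀ F : Matrix (Fin n) (Fin n) ℝ, F.IsSymm →
      ∀ (lam : Fin d → ℝ) (V : Matrix (Fin n) (Fin d) ℝ),
        SpectralBlock.IsTopEigenpairs F lam V →
      ∀ A : (Fin k → Fin n) → (Fin n → Fin k),
        SpectralBlock.IsKMeansRun (SpectralBlock.rescaled lam V) A →
      ∀ B : Matrix (Fin n) (Fin n) ℝ, B.rank ≤ d →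
        SpectralBlock.expectation
            (SpectralBlock.seeding (SpectralBlock.rows (SpectralBlock.rescaled lam V)) k)
            (fun z => ‖F - SpectralBlock.blockApprox lam V (A z)‖) ≤
          ‖F - B‖ + 2 * Real.sqrt (∑ i, |lam i|) * g k *
            SpectralBlock.phiOpt (SpectralBlock.rescaled lam V) k := by
  refine ⟨fun k => 8 * (Real.log k + 2), ?_, ?_⟩
  · have hlog : Tendsto (fun k : ℕ => Real.log (k : ℝ)) atTop atTop :=
      Real.tendsto_log_atTop.comp tendsto_natCast_atTop_atTop
    have hconst : (fun _ : ℕ => (2 : ℝ)) =o[atTop] fun k : ℕ => Real.log (k : ℝ) :=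
      isLittleO_const_left.2 (Or.inr (tendsto_norm_atTop_atTop.comp hlog))
    exact ((isBigO_refl _ _).add hconst.isBigO).const_mul_left 8
  · intro n d k _ hk F hF lam V hV A hA B hB
    have hnorm : ‖SpectralBlock.rescaled lam V‖ = √(∑ i, |lam i|) := by
      rw [← SpectralBlock.sq_norm_rescaled lam hV.orthonormal, Real.sqrt_sq (norm_nonneg _)]
    have htrunc := SpectralBlock.norm_sub_truncation_le hF hV B hB
    have hrun := SpectralBlock.expectation_norm_sub_replaceRows_le hk _ hA
    calc _ ≤ SpectralBlock.expectation
          (SpectralBlock.seeding (SpectralBlock.rows (SpectralBlock.rescaled lam V)) k)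
          (fun z => ‖F - B‖ + 2 * √(∑ i, |lam i|) * ‖SpectralBlock.rescaled lam V -
            SpectralBlock.replaceRows (SpectralBlock.rescaled lam V) (A z)‖) := by
          refine SpectralBlock.expectation_mono _ fun z => ?_
          refine (norm_sub_le_norm_sub_add_norm_sub F (V * Matrix.diagonal lam * Vᵀ) _).trans ?_
          rw [← hnorm]
          exact add_le_add htrunc (SpectralBlock.norm_truncation_sub_blockApprox_le lam V (A z))
      _ ≤ _ := by
          rw [SpectralBlock.expectation_const_add_mul, mul_assoc (2 * √(∑ i, |lam i|))]
          gcongr
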